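/- Let $(W,S)$ be a right-angled Coxeter system with $S$ finite, that is, $W=\langle S\mid (st)^{m_{st}}=1\rangle$ with $m_{ss}=1$ and $m_{st}\in\{2,\infty\}$ for $s\neq t$, and let $(q_s)_{s\in S}$ be integers with $q_s\geq 2$. Let $X$ be (the Davis geometric realization of) a regular right-angled building of type $(W,S)$ in which every $s$-panel is contained in exactly $q_s$ chambers, for each $s\in S$; such an $X$ is locally finite. Equip the group of type-preserving automorphisms of $X$ with the compact-open topology, and let $G$ be a closed subgroup of it that is cocompact, i.e. $G\backslash X$ is compact. Let $\Gamma\leq G$ be a lattice in $G$, that is, $\Gamma$ is discrete and the series $\sum_{\phi}|\mathrm{Stab}_\Gamma(\phi)|^{-1}$ converges, where $\phi$ runs over a set of representatives of the $\Gamma$-orbits of chambers of $X$; and suppose that $\Gamma$ is non-cocompact, i.e. $\Gamma\backslash X$ is not compact. If $\Gamma$ has a strict fundamental domain in $X$, that is, there is a subcomplex $Y\subset X$ that contains exactly one point of each $\Gamma$-orbit on $X$, then $\Gamma$ is not finitely generated. -/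

import Mathlib

/-- The right-angled condition on a Coxeter matrix: any two distinct generators satisfy
`m s t = 2` or `m s t = ∞` (Mathlib encodes `∞` as `0`). -/
def CoxeterMatrix.IsRightAngled {S : Type*} (M : CoxeterMatrix S) : Prop :=
  ∀ s t : S, s ≠ t → M s t = 2 ∨ M s t = 0

/-- A chamber system over `S`: a set `C` of chambers with, for every `s : S`, an equivalence
relation whose classes are the `s`-panels. -/
structure ChamberSystem (S C : Type*) where
  /-- `s`-equivalence of chambers -/
  panel : S → Setoid C

namespace ChamberSystem

variable {S C : Type*} (Φ : ChamberSystem S C)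

/-- Distinct chambers in a common `s`-panel. -/
def Adj (s : S) (φ ψ : C) : Prop := φ ≠ ψ ∧ Φ.panel s φ ψ

/-- There is a gallery of the given type between two chambers. -/
def HasGallery : List S → C → C → Prop
  | [], φ, ψ => φ = ψ
  | s :: ω, φ, ψ => ∃ χ, Φ.Adj s φ χ ∧ HasGallery ω χ ψ

/-- Two chambers are in the same residue of type `T`. -/
def residue (T : Set S) : Setoid C :=
  Relation.EqvGen.setoid fun φ ψ => ∃ s ∈ T, Φ.panel s φ ψ

/-- Every `s`-panel consists of exactly `q s` chambers. -/
def IsRegular (q : S → ℕ) : Prop :=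
  ∀ (s : S) (φ : C), Nat.card {ψ : C // Φ.panel s φ ψ} = q s

end ChamberSystem

/-- A building of type `(W, S)` with set of chambers `C`: a nonempty chamber system over `S` whose
panels have at least two chambers, with a `W`-valued distance `δ` such that, for each reduced word
`ω` in `S`, two chambers are joined by a gallery of type `ω` if and only if their distance is the
element of `W` represented by `ω`. -/
structure Building {S W : Type*} [Group W] {M : CoxeterMatrix S} (cs : CoxeterSystem M W)
    (C : Type*) extends ChamberSystem S C where
  nonempty : Nonempty C
  exists_adj : ∀ (s : S) (φ : C), ∃ ψ, toChamberSystem.Adj s φ ψ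
  /-- the `W`-valued distance -/
  δ : C → C → W
  hasGallery_iff : ∀ ω : List S, cs.IsReduced ω → ∀ φ ψ : C,
    toChamberSystem.HasGallery ω φ ψ ↔ δ φ ψ = cs.wordProd ω

/-- A set of generators of a right-angled Coxeter system is spherical (generates a finite
subgroup) if and only if its elements commute pairwise. -/
def CoxeterMatrix.IsSpherical {S : Type*} (M : CoxeterMatrix S) (T : Set S) : Prop :=
  ∀ s ∈ T, ∀ t ∈ T, s ≠ t → M s t = 2

/-- The Davis chamber `K` of a right-angled Coxeter system, with its cubical structure: the union
in `[0,1]^S` of the cubes `[0,1]^T`, for `T` spherical. The vertex of `K` corresponding to a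
spherical subset `T` is the indicator function of `T`, and the mirror `K_s` is `{x ∈ K | x s = 1}`.
It carries the topology of a subspace of `[0,1]^S`. -/
abbrev CoxeterMatrix.DavisChamber {S : Type*} (M : CoxeterMatrix S) : Type _ :=
  {x : S → unitInterval // M.IsSpherical {s | x s ≠ 0}}

namespace Building

variable {S W : Type*} [Group W] {M : CoxeterMatrix S} {cs : CoxeterSystem M W} {C : Type*}
  (B : Building cs C)

/-- The gluing relation on the disjoint union of copies of `K` indexed by the chambers: the points
`x` of the copies indexed by `φ` and `ψ` are identified if `φ` and `ψ` are in the same residue of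
type `{s | x ∈ K_s}`. -/
def glue : Setoid ((_ : C) × M.DavisChamber) where
  r p q := p.2 = q.2 ∧ B.residue {s | p.2.1 s = 1} p.1 q.1
  iseqv :=
    { refl := fun p => ⟨rfl, (B.residue _).refl p.1⟩
      symm := by
        rintro ⟨φ, x⟩ ⟨ψ, y⟩ ⟨h, h'⟩
        obtain rfl : x = y := h
        exact ⟨rfl, (B.residue _).symm h'⟩
      trans := by
        rintro ⟨φ, x⟩ ⟨ψ, y⟩ ⟨χ, z⟩ ⟨h, h'⟩ ⟨k, k'⟩
        obtain rfl : x = y := h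
        obtain rfl : x = z := k
        exact ⟨rfl, (B.residue _).trans h' k'⟩ }

/-- The geometric (Davis) realization of a right-angled building. -/
def Realization : Type _ := Quotient B.glue

/-- The quotient topology of the disjoint union of copies of `K`. -/
instance : TopologicalSpace B.Realization := inferInstanceAs (TopologicalSpace (Quotient B.glue))

/-- The point `x` of the chamber `φ`. -/
def point (φ : C) (x : M.DavisChamber) : B.Realization := Quotient.mk B.glue ⟨φ, x⟩

/-- The closed cubes of the realization: the faces of the cubes `[0,1]^T`, with `T` spherical, of
each chamber. -/
def IsCell (c : Set B.Realization) : Prop :=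
  ∃ (φ : C) (A T : Set S), A ⊆ T ∧ M.IsSpherical T ∧
    c = B.point φ '' {x | (∀ s ∈ A, x.1 s = 1) ∧ ∀ s, s ∉ T → x.1 s = 0}

/-- A subcomplex is a union of closed cells. -/
def IsSubcomplex (Y : Set B.Realization) : Prop :=
  ∃ F : Set (Set B.Realization), (∀ c ∈ F, B.IsCell c) ∧ Y = ⋃₀ F

/-- The permutations of the chambers that preserve `s`-equivalence for every `s`. -/
def autSubgroup : Subgroup (Equiv.Perm C) where
  carrier := {g | ∀ (s : S) (φ ψ : C), B.panel s (g φ) (g ψ) ↔ B.panel s φ ψ}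
  one_mem' := fun _ _ _ => Iff.rfl
  mul_mem' := fun {a b} ha hb s φ ψ => (ha s (b φ) (b ψ)).trans (hb s φ ψ)
  inv_mem' := fun {a} ha s φ ψ => by
    have h := ha s (a⁻¹ φ) (a⁻¹ ψ)
    have e : ∀ χ : C, a (a⁻¹ χ) = χ := fun χ => a.apply_symm_apply χ
    rw [e, e] at h
    exact h.symm

/-- The group of type-preserving automorphisms of the building. -/
def TypeAut : Type _ := B.autSubgroup

instance : Group B.TypeAut := inferInstanceAs (Group B.autSubgroup)

/-- The action on chambers. -/
instance : MulAction B.TypeAut C := inferInstanceAs (MulAction B.autSubgroup C)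

theorem panel_smul_iff (g : B.TypeAut) (s : S) (φ ψ : C) :
    B.panel s (g • φ) (g • ψ) ↔ B.panel s φ ψ :=
  g.2 s φ ψ

theorem residue_smul (g : B.TypeAut) (T : Set S) {φ ψ : C} (h : B.residue T φ ψ) :
    B.residue T (g • φ) (g • ψ) := by
  change Relation.EqvGen _ φ ψ at h
  change Relation.EqvGen _ (g • φ) (g • ψ)
  induction h with
  | rel φ ψ h =>
    obtain ⟨s, hs, h⟩ := h
    exact .rel _ _ ⟨s, hs, (B.panel_smul_iff g s φ ψ).2 h⟩
  | refl φ => exact .refl _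
  | symm φ ψ _ ih => exact .symm _ _ ih
  | trans φ ψ χ _ _ ih ih' => exact .trans _ _ _ ih ih'

/-- The action on the realization: `g` maps the point `x` of the chamber `φ` to the point `x` of
the chamber `g • φ`. -/
instance : MulAction B.TypeAut B.Realization where
  smul g := Quotient.map (fun p => ⟨g • p.1, p.2⟩)
    fun _ _ h => ⟨h.1, B.residue_smul g _ h.2⟩
  one_smul := by
    rintro ⟨φ, x⟩
    exact congrArg (fun χ => B.point χ x) (one_smul B.TypeAut φ)
  mul_smul := by
    rintro g h ⟨φ, x⟩
    exact congrArg (fun χ => B.point χ x) (mul_smul g h φ)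

theorem smul_point (g : B.TypeAut) (φ : C) (x : M.DavisChamber) :
    g • B.point φ x = B.point (g • φ) x := rfl

theorem continuous_smul (g : B.TypeAut) : Continuous fun p : B.Realization => g • p := by
  refine Continuous.quotient_map' (s := B.glue) (t := B.glue)
    (f := fun p => ⟨g • p.1, p.2⟩) ?_ fun _ _ h => ⟨h.1, B.residue_smul g _ h.2⟩
  exact continuous_sigma fun φ =>
    continuous_sigmaMk (σ := fun _ : C => M.DavisChamber) (i := g • φ)

/-- The self-map of the realization defined by an automorphism. -/
def toContinuousMap (g : B.TypeAut) : C(B.Realization, B.Realization) :=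
  ⟨fun p => g • p, B.continuous_smul g⟩

/-- The compact-open topology (`C(X, X)` carries the compact-open topology in Mathlib). -/
instance : TopologicalSpace B.TypeAut := TopologicalSpace.induced B.toContinuousMap inferInstance

/-- A group of automorphisms is cocompact if the quotient of the realization is compact. -/
def IsCocompact (G : Subgroup B.TypeAut) : Prop :=
  CompactSpace (Quotient (MulAction.orbitRel G B.Realization))

/-- `Γ` is a lattice in `G`: it is a subgroup of `G`, it is discrete, and the series of the
reciprocals `1 / |Stab_Γ(φ)|` converges, for `φ` in a set `F` of chambers that contains exactly one
chamber of each `Γ`-orbit. (The stabilizers in a discrete group are finite when the building is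
locally finite.) -/
def IsLattice (G Γ : Subgroup B.TypeAut) : Prop :=
  Γ ≤ G ∧ DiscreteTopology Γ ∧
    ∃ F : Set C, (∀ φ : C, ∃! ψ, ψ ∈ F ∧ ψ ∈ MulAction.orbit Γ φ) ∧
      Summable fun φ : F => ((Nat.card (MulAction.stabilizer Γ (φ : C)) : ℝ))⁻¹

/-- `Y` is a strict fundamental domain for `Γ`: a subcomplex that contains exactly one point of
each `Γ`-orbit on the realization. -/
def IsStrictFundamentalDomain (Γ : Subgroup B.TypeAut) (Y : Set B.Realization) : Prop :=
  B.IsSubcomplex Y ∧ ∀ p : B.Realization, ∃! y, y ∈ Y ∧ y ∈ MulAction.orbit Γ p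

end Building

/-! Suppose that `Γ` is finitely generated. The strict fundamental domain yields a retraction `r` of
the chambers onto orbit representatives that is constant on orbits and preserves panels
(`exists_retraction`). Fix a chamber `φ` with `r φ = φ`. Finite generation gives a finite set `E` of
chambers such that `φ` is joined to every `g • φ` by steps leaving chambers that `r` maps into `E`
(`exists_finite_stepIn_orbit`).

A chamber `χ` and a type `s` determine a wall, carried by the residue of type `M.star s` of `χ`.
Chambers of one panel on the wall cannot be joined without crossing it (`eq_of_offWall`). Let a
geodesic from `φ`, fixed by `r`, cross this wall on leaving `χ`. If the wall misses `E`, then `φ`,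
`g • φ` and `g • χ` can all be joined to `χ` off the wall whenever `g • χ` lies in the `s`-panel of
`χ`, so `g • χ = χ` (`smul_eq_of_panel`). Hence the stabilizer does not grow at this step.

A geodesic crosses each wall at most once, so at most `|S × E|` of its steps cross walls that meet
`E`, and each multiplies the order of the stabilizer by at most the size of a panel. The orders of
the stabilizers are therefore bounded (`exists_card_stabilizer_le`). Convergence of the lattice
series then leaves finitely many orbits of chambers, and `Γ` is cocompact, a contradiction. -/

namespace CoxeterMatrix

variable {S : Type*}

/-- The generator `s` together with the generators that commute with it. -/
def star (M : CoxeterMatrix S) (s : S) : Set S := {t | t = s ∨ M s t = 2}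

theorem self_mem_star (M : CoxeterMatrix S) (s : S) : s ∈ M.star s := Or.inl rfl

end CoxeterMatrix

/-! ### Right-angled Coxeter groups: parabolic subgroups and retractions -/

namespace CoxeterSystem

variable {S W : Type*} [Group W] {M : CoxeterMatrix S} (cs : CoxeterSystem M W)

theorem simple_mul_simple_comm {s t : S} (h : M s t = 2) :
    cs.simple s * cs.simple t = cs.simple t * cs.simple s := by
  have h2 := cs.simple_mul_simple_pow s t
  rw [h, pow_two] at h2
  rw [eq_inv_of_mul_eq_one_left h2, mul_inv_rev, inv_simple, inv_simple]

theorem simple_mul_comm_of_mem_star {s t : S} (h : t ∈ M.star s) :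
    cs.simple s * cs.simple t = cs.simple t * cs.simple s := by
  rcases h with rfl | h
  · rfl
  · exact cs.simple_mul_simple_comm h

theorem simple_mul_wordProd_comm {s : S} {ω : List S} (h : ∀ t ∈ ω, t ∈ M.star s) :
    cs.simple s * cs.wordProd ω = cs.wordProd ω * cs.simple s := by
  induction ω with
  | nil => simp
  | cons t ω ih =>
    rw [wordProd_cons, ← mul_assoc, cs.simple_mul_comm_of_mem_star (h t (by simp)), mul_assoc,
      ih fun u hu => h u (by simp [hu]), mul_assoc]

/-- The standard parabolic subgroup generated by `T`. -/
def parabolic (T : Set S) : Subgroup W := Subgroup.closure (cs.simple '' T)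

theorem simple_mem_parabolic {T : Set S} {t : S} (h : t ∈ T) : cs.simple t ∈ cs.parabolic T :=
  Subgroup.subset_closure ⟨t, h, rfl⟩

-- The product of two distinct generators has order 2 or ∞, so sending some generators to 1 respects
-- the relations.
open Classical in
theorem isLiftable_kill (hM : M.IsRightAngled) (T : Set S) :
    M.IsLiftable fun t => if t ∈ T then cs.simple t else 1 := by
  intro s t
  rcases eq_or_ne s t with rfl | hst
  · by_cases hs : s ∈ T <;> simp [hs]
  · rcases hM s t hst with h | h
    · have h2 := cs.simple_mul_simple_pow s t
      rw [h] at h2 ⊢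
      by_cases hs : s ∈ T <;> by_cases ht : t ∈ T <;> simp [hs, ht, h2]
    · simp [h]

open Classical in
/-- The retraction of a right-angled Coxeter group onto a standard parabolic subgroup that kills
the other generators. -/
noncomputable def retraction (hM : M.IsRightAngled) (T : Set S) : W →* W :=
  cs.lift ⟨_, cs.isLiftable_kill hM T⟩

open Classical in
theorem retraction_simple (hM : M.IsRightAngled) (T : Set S) (t : S) :
    cs.retraction hM T (cs.simple t) = if t ∈ T then cs.simple t else 1 :=
  cs.lift_apply_simple (cs.isLiftable_kill hM T) t

theorem retraction_of_mem (hM : M.IsRightAngled) {T : Set S} {w : W} (hw : w ∈ cs.parabolic T) :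
    cs.retraction hM T w = w := by
  unfold parabolic at hw
  induction hw using Subgroup.closure_induction with
  | mem x hx =>
    obtain ⟨t, ht, rfl⟩ := hx
    simp [retraction_simple, ht]
  | one => simp
  | mul x y _ _ hx hy => simp [hx, hy]
  | inv x _ hx => simp [hx]

open Classical in
theorem retraction_wordProd (hM : M.IsRightAngled) (T : Set S) (ω : List S) :
    cs.retraction hM T (cs.wordProd ω) = cs.wordProd (ω.filter (· ∈ T)) := by
  induction ω with
  | nil => simp
  | cons t ω ih =>
    by_cases ht : t ∈ T <;> simp [wordProd_cons, ih, retraction_simple, ht]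

/-- The letters of a reduced word that represents an element of a standard parabolic subgroup. -/
theorem mem_of_isReduced_of_mem_parabolic (hM : M.IsRightAngled) {T : Set S} {ω : List S}
    (hω : cs.IsReduced ω) (h : cs.wordProd ω ∈ cs.parabolic T) : ∀ t ∈ ω, t ∈ T := by
  classical
  have h1 := cs.retraction_of_mem hM h
  rw [retraction_wordProd] at h1
  -- The retraction fixes the element and deletes the letters outside `T`; a reduced word has
  -- minimal length, so nothing is deleted.
  have h2 := cs.length_wordProd_le (ω.filter (· ∈ T))
  rw [h1, hω.eq] at h2
  have h3 := List.length_filter_eq_length_iff.1 (le_antisymm (List.length_filter_le _ ω) h2)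
  simpa using h3

theorem simple_ne_simple (hM : M.IsRightAngled) {s t : S} (h : s ≠ t) :
    cs.simple s ≠ cs.simple t := by
  intro e
  have h1 := congrArg (cs.retraction hM {s}) e
  rw [retraction_simple, retraction_simple, if_pos (Set.mem_singleton s),
    if_neg (by simpa using h.symm)] at h1
  have h2 := cs.length_simple s
  rw [h1, length_one] at h2
  exact zero_ne_one h2

theorem isReduced_singleton (s : S) : cs.IsReduced [s] := by
  simp [IsReduced]

theorem isReduced_pair (hM : M.IsRightAngled) {s t : S} (h : s ≠ t) : cs.IsReduced [s, t] := by
  have h1 : cs.wordProd [s, t] = cs.simple s * cs.simple t := by simp [wordProd_cons]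
  rw [IsReduced, h1]
  rcases cs.length_mul_simple (cs.simple s) t with h2 | h2
  · rw [h2, length_simple]; rfl
  · rw [length_simple] at h2
    have h3 := (cs.length_eq_zero_iff).1 (Nat.succ_injective h2)
    exact absurd (by rw [eq_inv_of_mul_eq_one_left h3, inv_simple]) (cs.simple_ne_simple hM h)

/-! ### The two sides of a wall -/

open Classical in
/-- The involution of `W × ZMod 2` by which the generator `t` acts, where the second component
counts the crossings of the wall of `s`. -/
noncomputable def wallPerm (s t : S) : Equiv.Perm (W × ZMod 2) :=
  Function.Involutive.toPerm
    (fun p => (cs.simple t * p.1, p.2 + if t = s ∧ p.1 ∈ cs.parabolic (M.star s) then 1 else 0))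
    (by
      rintro ⟨x, e⟩
      have h2 : ∀ e : ZMod 2, e + 1 + 1 = e := by decide
      by_cases ht : t = s
      · subst ht
        have h := cs.simple_mem_parabolic (M.self_mem_star t)
        have h1 : cs.simple t * x ∈ cs.parabolic (M.star t) ↔ x ∈ cs.parabolic (M.star t) :=
          Subgroup.mul_mem_cancel_left _ h
        by_cases hx : x ∈ cs.parabolic (M.star t) <;> simp [h1, hx, h2]
      · simp [ht])

open Classical in
theorem wallPerm_apply (s t : S) (x : W) (e : ZMod 2) : cs.wallPerm s t (x, e) =
    (cs.simple t * x, e + if t = s ∧ x ∈ cs.parabolic (M.star s) then 1 else 0) := rfl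

theorem wallPerm_mul_self (s t : S) : cs.wallPerm s t * cs.wallPerm s t = 1 :=
  Equiv.ext fun p => (cs.wallPerm s t).left_inv p

/-- The flip made by `s` depends on membership in the parabolic subgroup of `M.star s`, which left
multiplication by a generator commuting with `s` preserves. -/
theorem wallPerm_comm (s : S) {t u : S} (h : M t u = 2) :
    cs.wallPerm s t * cs.wallPerm s u = cs.wallPerm s u * cs.wallPerm s t := by
  classical
  have hc := cs.simple_mul_simple_comm h
  ext1 ⟨x, e⟩
  simp only [Equiv.Perm.mul_apply, wallPerm_apply, ← mul_assoc, hc]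
  by_cases ht : t = s <;> by_cases hu : u = s
  · rw [ht, hu]
  · subst ht
    have h1 : cs.simple u * x ∈ cs.parabolic (M.star t) ↔ x ∈ cs.parabolic (M.star t) :=
      Subgroup.mul_mem_cancel_left _ (cs.simple_mem_parabolic (Or.inr h))
    simp only [hu, false_and, if_false, add_zero]
    exact Prod.ext rfl (congrArg (e + ·) (if_congr (and_congr_right fun _ => h1) rfl rfl))
  · subst hu
    have h1 : cs.simple t * x ∈ cs.parabolic (M.star u) ↔ x ∈ cs.parabolic (M.star u) :=
      Subgroup.mul_mem_cancel_left _
        (cs.simple_mem_parabolic (Or.inr (by rw [M.symmetric, h])))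
    simp only [ht, false_and, if_false, add_zero]
    exact Prod.ext rfl (congrArg (e + ·) (if_congr (and_congr_right fun _ => h1.symm) rfl rfl))
  · simp [ht, hu]

theorem isLiftable_wallPerm (hM : M.IsRightAngled) (s : S) : M.IsLiftable (cs.wallPerm s) := by
  intro t u
  rcases eq_or_ne t u with rfl | htu
  · simp [wallPerm_mul_self]
  · rcases hM t u htu with h | h
    · rw [h, pow_two]
      nth_rewrite 1 [cs.wallPerm_comm s h]
      rw [mul_assoc, ← mul_assoc (cs.wallPerm s t), wallPerm_mul_self, one_mul, wallPerm_mul_self]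
    · simp [h]

/-- The action of `W` on `W × ZMod 2` defined by `wallPerm`. -/
noncomputable def wallHom (hM : M.IsRightAngled) (s : S) : W →* Equiv.Perm (W × ZMod 2) :=
  cs.lift ⟨_, cs.isLiftable_wallPerm hM s⟩

theorem wallHom_simple (hM : M.IsRightAngled) (s t : S) :
    cs.wallHom hM s (cs.simple t) = cs.wallPerm s t :=
  cs.lift_apply_simple (cs.isLiftable_wallPerm hM s) t

theorem wallHom_apply_fst (hM : M.IsRightAngled) (s : S) (w : W) (p : W × ZMod 2) :
    (cs.wallHom hM s w p).1 = w * p.1 := by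
  induction w using cs.simple_induction_left with
  | one => simp
  | mul_simple_left w t ih =>
    rw [map_mul, Equiv.Perm.mul_apply, wallHom_simple, mul_assoc, ← ih]
    rfl

/-- The side of the wall of `s` on which `w` lies. -/
noncomputable def side (hM : M.IsRightAngled) (s : S) (w : W) : ZMod 2 :=
  (cs.wallHom hM s w⁻¹ (1, 0)).2

theorem side_one (hM : M.IsRightAngled) (s : S) : cs.side hM s 1 = 0 := by
  simp [side]

-- The inverse in `side` turns the left action into right multiplication, which is how `δ χ` changes
-- along a gallery.
open Classical in
theorem side_mul_simple (hM : M.IsRightAngled) (s : S) (w : W) (t : S) :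
    cs.side hM s (w * cs.simple t) =
      cs.side hM s w + if t = s ∧ w ∈ cs.parabolic (M.star s) then 1 else 0 := by
  have h : cs.wallHom hM s w⁻¹ (1, 0) = (w⁻¹, cs.side hM s w) :=
    Prod.ext (by rw [wallHom_apply_fst, mul_one]) rfl
  rw [side, mul_inv_rev, inv_simple, map_mul, Equiv.Perm.mul_apply, h, wallHom_simple,
    wallPerm_apply]
  simp

theorem side_simple (hM : M.IsRightAngled) (s : S) : cs.side hM s (cs.simple s) = 1 := by
  have := cs.side_mul_simple hM s 1 s
  rw [one_mul, side_one] at this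
  simpa [one_mem] using this

end CoxeterSystem

/-! ### Galleries and residues -/

namespace ChamberSystem

variable {S C : Type*} (Φ : ChamberSystem S C)

theorem hasGallery_append {ω ω' : List S} {φ ψ : C} :
    Φ.HasGallery (ω ++ ω') φ ψ ↔ ∃ χ, Φ.HasGallery ω φ χ ∧ Φ.HasGallery ω' χ ψ := by
  induction ω generalizing φ with
  | nil => simp [HasGallery]
  | cons s ω ih =>
    simp only [List.cons_append, HasGallery, ih]
    constructor
    · rintro ⟨χ, h, ξ, h1, h2⟩
      exact ⟨ξ, ⟨χ, h, h1⟩, h2⟩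
    · rintro ⟨ξ, ⟨χ, h, h1⟩, h2⟩
      exact ⟨χ, h, ξ, h1, h2⟩

theorem hasGallery_singleton {s : S} {φ ψ : C} : Φ.HasGallery [s] φ ψ ↔ Φ.Adj s φ ψ := by
  simp [HasGallery]

theorem residue_of_panel {T : Set S} {s : S} (hs : s ∈ T) {φ ψ : C} (h : Φ.panel s φ ψ) :
    Φ.residue T φ ψ :=
  .rel _ _ ⟨s, hs, h⟩

theorem residue_of_hasGallery {T : Set S} {ω : List S} (hω : ∀ t ∈ ω, t ∈ T) {φ ψ : C}
    (h : Φ.HasGallery ω φ ψ) : Φ.residue T φ ψ := by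
  induction ω generalizing φ with
  | nil => exact h ▸ (Φ.residue T).refl _
  | cons s ω ih =>
    obtain ⟨χ, h1, h2⟩ := h
    exact (Φ.residue T).trans (Φ.residue_of_panel (hω s (by simp)) h1.2)
      (ih (fun t ht => hω t (by simp [ht])) h2)

theorem residue_map {T : Set S} {f : C → C}
    (hf : ∀ s φ ψ, Φ.panel s φ ψ → Φ.panel s (f φ) (f ψ)) {φ ψ : C} (h : Φ.residue T φ ψ) :
    Φ.residue T (f φ) (f ψ) := by
  change Relation.EqvGen _ φ ψ at h
  induction h with
  | rel φ ψ h =>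
    obtain ⟨s, hs, h⟩ := h
    exact Φ.residue_of_panel hs (hf s φ ψ h)
  | refl φ => exact (Φ.residue T).refl _
  | symm φ ψ _ ih => exact (Φ.residue T).symm ih
  | trans φ ψ χ _ _ ih ih' => exact (Φ.residue T).trans ih ih'

theorem residue_empty {φ ψ : C} (h : Φ.residue ∅ φ ψ) : φ = ψ := by
  change Relation.EqvGen _ φ ψ at h
  induction h with
  | rel φ ψ h => exact absurd h.choose_spec.1 (Set.notMem_empty _)
  | refl φ => rfl
  | symm φ ψ _ ih => exact ih.symm
  | trans φ ψ χ _ _ ih ih' => exact ih.trans ih'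

theorem residue_singleton {s : S} {φ ψ : C} (h : Φ.residue {s} φ ψ) : Φ.panel s φ ψ := by
  change Relation.EqvGen _ φ ψ at h
  induction h with
  | rel φ ψ h =>
    obtain ⟨t, rfl, h⟩ := h
    exact h
  | refl φ => exact (Φ.panel s).refl _
  | symm φ ψ _ ih => exact (Φ.panel s).symm ih
  | trans φ ψ χ _ _ ih ih' => exact (Φ.panel s).trans ih ih'

end ChamberSystem

/-! ### The Weyl distance, walls and geodesic galleries -/

namespace Building

variable {S W : Type*} [Group W] {M : CoxeterMatrix S} {cs : CoxeterSystem M W} {C : Type*}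
  (B : Building cs C)

theorem exists_gallery (φ ψ : C) :
    ∃ ω, cs.IsReduced ω ∧ B.δ φ ψ = cs.wordProd ω ∧ B.HasGallery ω φ ψ := by
  obtain ⟨ω, hω, h⟩ := cs.exists_isReduced (B.δ φ ψ)
  exact ⟨ω, hω, h, (B.hasGallery_iff ω hω φ ψ).2 h⟩

theorem δ_self (φ : C) : B.δ φ φ = 1 := by
  have h : cs.IsReduced [] := by simp [CoxeterSystem.IsReduced]
  simpa using (B.hasGallery_iff [] h φ φ).1 rfl

theorem δ_of_adj {s : S} {φ ψ : C} (h : B.Adj s φ ψ) : B.δ φ ψ = cs.simple s := by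
  simpa using (B.hasGallery_iff [s] (cs.isReduced_singleton s) φ ψ).1
    (B.hasGallery_singleton.2 h)

/-- If `t` lengthens `δ χ α`, a geodesic to `α` extends to `β`. If `t` shortens it, some geodesic to
`α` enters the panel at a chamber `ξ` one step earlier, and `β` is either `ξ` or adjacent to `ξ`. -/
theorem δ_of_panel (χ : C) {t : S} {α β : C} (h : B.panel t α β) :
    B.δ χ β = B.δ χ α ∨ B.δ χ β = B.δ χ α * cs.simple t := by
  rcases eq_or_ne α β with rfl | hne
  · exact Or.inl rfl
  obtain ⟨ω, hω, h1, h2⟩ := B.exists_gallery χ α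
  rcases cs.length_mul_simple (B.δ χ α) t with h3 | h3
  · right
    have h4 : cs.wordProd (ω ++ [t]) = B.δ χ α * cs.simple t := by
      simp [cs.wordProd_append, h1]
    have h5 : cs.IsReduced (ω ++ [t]) := by
      rw [CoxeterSystem.IsReduced, h4, h3, h1, hω.eq]; simp
    rw [← h4]
    exact (B.hasGallery_iff _ h5 _ _).1
      (B.hasGallery_append.2 ⟨α, h2, B.hasGallery_singleton.2 ⟨hne, h⟩⟩)
  · obtain ⟨ω', hω', h4⟩ := cs.exists_isReduced (B.δ χ α * cs.simple t)
    have h5 : cs.wordProd (ω' ++ [t]) = B.δ χ α := by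
      simp [cs.wordProd_append, ← h4]
    have h6 : cs.IsReduced (ω' ++ [t]) := by
      rw [CoxeterSystem.IsReduced, h5, ← h3, h4, hω'.eq]; simp
    obtain ⟨ξ, h7, h8⟩ := B.hasGallery_append.1 ((B.hasGallery_iff _ h6 χ α).2 h5.symm)
    rw [B.hasGallery_singleton] at h8
    rcases eq_or_ne ξ β with rfl | hne'
    · right
      rw [h4]
      exact (B.hasGallery_iff _ hω' _ _).1 h7
    · left
      rw [← h5]
      exact (B.hasGallery_iff _ h6 _ _).1 (B.hasGallery_append.2
        ⟨ξ, h7, B.hasGallery_singleton.2 ⟨hne', (B.panel t).trans h8.2 h⟩⟩)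

theorem length_δ_le_of_panel (χ : C) {t : S} {α β : C} (h : B.panel t α β) :
    cs.length (B.δ χ β) ≤ cs.length (B.δ χ α) + 1 := by
  rcases B.δ_of_panel χ h with e | e <;> rw [e]
  · omega
  · have := cs.length_mul_le (B.δ χ α) (cs.simple t)
    rwa [cs.length_simple] at this

theorem δ_mem_parabolic {T : Set S} {χ α : C} (h : B.residue T χ α) :
    B.δ χ α ∈ cs.parabolic T := by
  have key : ∀ α β, B.residue T α β →
      (B.δ χ α ∈ cs.parabolic T ↔ B.δ χ β ∈ cs.parabolic T) := by
    intro α β h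
    change Relation.EqvGen _ α β at h
    induction h with
    | rel α β h =>
      obtain ⟨t, ht, h⟩ := h
      rcases B.δ_of_panel χ h with e | e <;> rw [e]
      exact (Subgroup.mul_mem_cancel_right _ (cs.simple_mem_parabolic ht)).symm
    | refl α => rfl
    | symm α β _ ih => exact ih.symm
    | trans α β γ _ _ ih ih' => exact ih.trans ih'
  rw [← key χ α h, δ_self]
  exact one_mem _

/-- Every letter of a reduced word for the distance lies in `T`, so a geodesic gallery stays in the
residue. -/
theorem residue_of_δ_mem_parabolic (hM : M.IsRightAngled) {T : Set S} {χ α : C}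
    (h : B.δ χ α ∈ cs.parabolic T) : B.residue T χ α := by
  obtain ⟨ω, hω, h1, h2⟩ := B.exists_gallery χ α
  rw [h1] at h
  exact B.residue_of_hasGallery (cs.mem_of_isReduced_of_mem_parabolic hM hω h) h2

/-- Two chambers in a common panel that does not cross the wall of type `s` of the chamber `χ`. -/
def OffWall (s : S) (χ α β : C) : Prop :=
  ∃ t, B.panel t α β ∧ (t = s → ¬ B.residue (M.star s) χ α)

/-- The side can change only at a step of type `s` whose distance from `χ` lies in the parabolic
subgroup of `M.star s`, which means that the step starts in the residue of the wall. -/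
theorem side_eq_of_offWall (hM : M.IsRightAngled) {s : S} {χ α β : C}
    (h : Relation.EqvGen (B.OffWall s χ) α β) :
    cs.side hM s (B.δ χ α) = cs.side hM s (B.δ χ β) := by
  classical
  induction h with
  | rel α β h =>
    obtain ⟨t, h, h1⟩ := h
    rcases B.δ_of_panel χ h with e | e <;> rw [e]
    rw [cs.side_mul_simple, if_neg, add_zero]
    rintro ⟨h2, h3⟩
    exact h1 h2 (B.residue_of_δ_mem_parabolic hM h3)
  | refl α => rfl
  | symm α β _ ih => exact ih.symm
  | trans α β γ _ _ ih ih' => exact ih.trans ih'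

/-- A wall separates the chambers of each of its panels. -/
theorem eq_of_offWall (hM : M.IsRightAngled) {s : S} {χ χ' : C} (hp : B.panel s χ χ')
    (h : Relation.EqvGen (B.OffWall s χ) χ χ') : χ = χ' := by
  by_contra hne
  have h1 := B.side_eq_of_offWall hM h
  rw [B.δ_self, B.δ_of_adj ⟨hne, hp⟩, cs.side_one, cs.side_simple] at h1
  exact zero_ne_one h1

/-- A gallery of reduced type crosses a wall at most once. -/
theorem not_residue_star_of_isReduced (hM : M.IsRightAngled) {s : S} {ω : List S} {α β : C}
    (hg : B.HasGallery (s :: ω) α β) (hr : cs.IsReduced (s :: ω ++ [s])) :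
    ¬ B.residue (M.star s) α β := by
  intro h
  have hω : cs.IsReduced (s :: ω) := by simpa using hr.take (s :: ω).length
  have h1 := B.δ_mem_parabolic h
  rw [(B.hasGallery_iff _ hω _ _).1 hg] at h1
  have h2 := cs.mem_of_isReduced_of_mem_parabolic hM hω h1
  -- All letters of `ω` commute with `s`, so the two outer letters cancel and the word is not
  -- reduced.
  have h3 : cs.wordProd (s :: ω ++ [s]) = cs.wordProd ω := by
    rw [cs.wordProd_append, cs.wordProd_cons,
      cs.simple_mul_wordProd_comm fun t ht => h2 t (by simp [ht])]
    simp
  have h4 := hr.eq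
  rw [h3] at h4
  have h5 := cs.length_wordProd_le ω
  simp at h4
  omega

theorem exists_gallery_function (φ ψ : C) : ∃ (ω : List S) (c : ℕ → C), cs.IsReduced ω ∧
    cs.length (B.δ φ ψ) = ω.length ∧ c 0 = φ ∧ c ω.length = ψ ∧
    ∀ i (hi : i < ω.length), B.panel ω[i] (c i) (c (i + 1)) := by
  obtain ⟨ω, hω, h1, h2⟩ := B.exists_gallery φ ψ
  refine ⟨ω, ?_⟩
  suffices ∃ c : ℕ → C, c 0 = φ ∧ c ω.length = ψ ∧
      ∀ i (hi : i < ω.length), B.panel ω[i] (c i) (c (i + 1)) by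
    obtain ⟨c, h⟩ := this
    exact ⟨c, hω, by rw [h1, hω.eq], h⟩
  clear hω h1
  induction ω generalizing φ with
  | nil => exact ⟨fun _ => φ, rfl, h2, by simp⟩
  | cons s ω ih =>
    obtain ⟨χ, h3, h4⟩ := h2
    obtain ⟨c, c0, cn, hc⟩ := ih χ h4
    refine ⟨fun i => Nat.casesOn i φ c, rfl, cn, ?_⟩
    rintro (_ | i) hi
    · simpa [c0] using h3.2
    · exact hc i (by simpa using hi)

theorem hasGallery_slice {ω : List S} {c : ℕ → C}
    (hc : ∀ i (hi : i < ω.length), B.Adj ω[i] (c i) (c (i + 1))) (k j : ℕ)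
    (h : j + k ≤ ω.length) : B.HasGallery ((ω.drop j).take k) (c j) (c (j + k)) := by
  induction k generalizing j with
  | zero => simp [ChamberSystem.HasGallery]
  | succ k ih =>
    have hj : j < ω.length := by omega
    rw [List.drop_eq_getElem_cons hj, List.take_succ_cons]
    refine ⟨c (j + 1), hc j hj, ?_⟩
    have := ih (j + 1) (by omega)
    rwa [show j + 1 + k = j + (k + 1) by omega] at this

theorem not_residue_star_of_lt (hM : M.IsRightAngled) {ω : List S} (hω : cs.IsReduced ω)
    {c : ℕ → C} (hc : ∀ i (hi : i < ω.length), B.Adj ω[i] (c i) (c (i + 1))) {i j : ℕ}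
    (hij : i < j) (hj : j < ω.length) (h : ω[i] = ω[j]) :
    ¬ B.residue (M.star ω[i]) (c i) (c j) := by
  obtain ⟨k, rfl⟩ : ∃ k, j = i + (k + 1) := ⟨j - i - 1, by omega⟩
  have hi : i < ω.length := by omega
  have h1 := B.hasGallery_slice hc (k + 1) i hj.le
  rw [List.drop_eq_getElem_cons hi, List.take_succ_cons] at h1
  refine B.not_residue_star_of_isReduced hM h1 ?_
  have h2 := (hω.drop i).take (k + 2)
  rw [List.drop_eq_getElem_cons hi, List.take_succ_cons, List.take_succ_eq_append_getElem
    (by simp; omega)] at h2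
  have h3 : (ω.drop (i + 1))[k]'(by simp; omega) = ω[i] := by
    rw [h, List.getElem_drop]
    congr 1
    omega
  rw [h3] at h2
  simpa using h2

/-- A map that preserves panels and fixes two chambers maps a geodesic gallery between them to
a geodesic gallery. -/
theorem exists_gallery_fixed {r : C → C} (hr : ∀ s φ ψ, B.panel s φ ψ → B.panel s (r φ) (r ψ))
    (hrr : ∀ φ, r (r φ) = r φ) {φ ψ : C} (hφ : r φ = φ) (hψ : r ψ = ψ) :
    ∃ (ω : List S) (c : ℕ → C), cs.IsReduced ω ∧ c 0 = φ ∧ c ω.length = ψ ∧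
      (∀ i, r (c i) = c i) ∧ ∀ i (hi : i < ω.length), B.Adj ω[i] (c i) (c (i + 1)) := by
  obtain ⟨ω, c, hω, hl, c0, cn, hc⟩ := B.exists_gallery_function φ ψ
  refine ⟨ω, fun i => r (c i), hω, by simp [c0, hφ], by simp [cn, hψ], fun i => hrr _, ?_⟩
  intro i hi
  have hp : ∀ i (hi : i < ω.length), B.panel ω[i] (r (c i)) (r (c (i + 1))) :=
    fun i hi => hr _ _ _ (hc i hi)
  refine ⟨fun (hst : r (c i) = r (c (i + 1))) => ?_, hp i hi⟩
  -- A stutter at `i` saves one step from there on, so the image gallery would reach `ψ` in fewer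
  -- steps than the distance allows.
  have h1 : ∀ j ≤ ω.length, cs.length (B.δ φ (r (c j))) ≤ j := by
    intro j
    induction j with
    | zero => simp [c0, hφ, B.δ_self]
    | succ j ih =>
      intro hj
      have := B.length_δ_le_of_panel φ (hp j hj)
      have := ih (by omega)
      omega
  have h2 : ∀ j, i + 1 ≤ j → j ≤ ω.length → cs.length (B.δ φ (r (c j))) + 1 ≤ j := by
    intro j hj
    induction j, hj using Nat.le_induction with
    | base =>
      intro _
      have := h1 i hi.le
      rw [← hst]
      omega
    | succ j hj ih =>
      intro hj'
      have := B.length_δ_le_of_panel φ (hp j hj')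
      have := ih (by omega)
      omega
  have h3 := h2 ω.length hi le_rfl
  rw [cn, hψ, hl] at h3
  omega

end Building

/-! ### Local finiteness, and discrete groups of automorphisms -/

open scoped Topology

namespace Building

variable {S W : Type*} [Group W] {M : CoxeterMatrix S} {cs : CoxeterSystem M W} {C : Type*}
  (B : Building cs C)

/-- The words `[s, t]` and `[t, s]` are both reduced and represent the same element, so a gallery of
one type can be exchanged for one of the other. -/
theorem exists_panel_comm (hM : M.IsRightAngled) {s t : S} (hst : s ≠ t) (h : M s t = 2)
    {φ χ ψ : C} (h1 : B.panel s φ χ) (h2 : B.panel t χ ψ) :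
    ∃ ξ, B.panel t φ ξ ∧ B.panel s ξ ψ := by
  rcases eq_or_ne φ χ with rfl | n1
  · exact ⟨ψ, h2, (B.panel s).refl _⟩
  rcases eq_or_ne χ ψ with rfl | n2
  · exact ⟨φ, (B.panel t).refl _, h1⟩
  have h3 : B.HasGallery [s, t] φ ψ := ⟨χ, ⟨n1, h1⟩, ψ, ⟨n2, h2⟩, rfl⟩
  have h4 := (B.hasGallery_iff _ (cs.isReduced_pair hM hst) _ _).1 h3
  have h5 : cs.wordProd [s, t] = cs.wordProd [t, s] := by
    simp [cs.wordProd_cons, cs.simple_mul_simple_comm h]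
  obtain ⟨ξ, k1, ψ', k2, rfl⟩ :=
    (B.hasGallery_iff _ (cs.isReduced_pair hM hst.symm) _ _).2 (h4.trans h5)
  exact ⟨ξ, k1.2, k2.2⟩

theorem exists_panel_residue_comm (hM : M.IsRightAngled) {s : S} {T : Set S}
    (hT : ∀ t ∈ T, t ≠ s ∧ M s t = 2) {φ ψ : C} (h : B.residue T φ ψ) :
    (∀ ψ', B.panel s ψ ψ' → ∃ φ', B.panel s φ φ' ∧ B.residue T φ' ψ') ∧
      ∀ φ', B.panel s φ φ' → ∃ ψ', B.panel s ψ ψ' ∧ B.residue T ψ' φ' := by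
  change Relation.EqvGen _ φ ψ at h
  induction h with
  | rel φ ψ h =>
    obtain ⟨t, ht, h⟩ := h
    have hts : M t s = 2 := (M.symmetric t s).trans (hT t ht).2
    constructor
    · intro ψ' h'
      obtain ⟨ξ, h1, h2⟩ := B.exists_panel_comm hM (hT t ht).1 hts h h'
      exact ⟨ξ, h1, B.residue_of_panel ht h2⟩
    · intro φ' h'
      obtain ⟨ξ, h1, h2⟩ := B.exists_panel_comm hM (hT t ht).1 hts ((B.panel t).symm h) h'
      exact ⟨ξ, h1, B.residue_of_panel ht h2⟩
  | refl φ => exact ⟨fun ψ' h => ⟨ψ', h, (B.residue T).refl _⟩,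
      fun ψ' h => ⟨ψ', h, (B.residue T).refl _⟩⟩
  | symm φ ψ _ ih => exact ⟨ih.2, ih.1⟩
  | trans φ χ ψ _ _ ih ih' =>
    constructor
    · intro ψ' h
      obtain ⟨χ', h1, h2⟩ := ih'.1 ψ' h
      obtain ⟨φ', h3, h4⟩ := ih.1 χ' h1
      exact ⟨φ', h3, (B.residue T).trans h4 h2⟩
    · intro φ' h
      obtain ⟨χ', h1, h2⟩ := ih.2 φ' h
      obtain ⟨ψ', h3, h4⟩ := ih'.2 χ' h1
      exact ⟨ψ', h3, (B.residue T).trans h4 h2⟩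

theorem exists_of_residue_insert (hM : M.IsRightAngled) {s : S} {T : Set S}
    (hT : ∀ t ∈ T, t ≠ s ∧ M s t = 2) {φ ψ : C} (h : B.residue (insert s T) φ ψ) :
    ∃ χ, B.panel s φ χ ∧ B.residue T χ ψ := by
  -- The equivalence with a free base chamber `ξ` is symmetric in `φ` and `ψ`, as induction on the
  -- generated relation requires.
  suffices H : ∀ φ ψ, B.residue (insert s T) φ ψ → ∀ ξ,
      ((∃ χ, B.panel s ξ χ ∧ B.residue T χ φ) ↔ ∃ χ, B.panel s ξ χ ∧ B.residue T χ ψ) from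
    (H φ ψ h φ).1 ⟨φ, (B.panel s).refl _, (B.residue T).refl _⟩
  intro φ ψ h
  change Relation.EqvGen _ φ ψ at h
  induction h with
  | rel φ ψ h =>
    have key : ∀ {φ ψ : C}, (∃ t ∈ insert s T, B.panel t φ ψ) → ∀ ξ,
        (∃ χ, B.panel s ξ χ ∧ B.residue T χ φ) → ∃ χ, B.panel s ξ χ ∧ B.residue T χ ψ := by
      rintro φ ψ ⟨t, rfl | ht, hp⟩ ξ ⟨χ, h1, h2⟩
      · obtain ⟨χ', h3, h4⟩ := (B.exists_panel_residue_comm hM hT h2).1 ψ hp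
        exact ⟨χ', (B.panel t).trans h1 h3, h4⟩
      · exact ⟨χ, h1, (B.residue T).trans h2 (B.residue_of_panel ht hp)⟩
    obtain ⟨t, ht, h⟩ := h
    exact fun ξ => ⟨key ⟨t, ht, h⟩ ξ, key ⟨t, ht, (B.panel t).symm h⟩ ξ⟩
  | refl φ => exact fun _ => Iff.rfl
  | symm φ ψ _ ih => exact fun ξ => (ih ξ).symm
  | trans φ χ ψ _ _ ih ih' => exact fun ξ => (ih ξ).trans (ih' ξ)

/-- Spherical residues of a locally finite right-angled building are finite. -/
theorem finite_residue (hM : M.IsRightAngled) (hB : ∀ s φ, {ψ | B.panel s φ ψ}.Finite)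
    {T : Set S} (hfin : T.Finite) (hT : M.IsSpherical T) (φ : C) :
    {ψ | B.residue T φ ψ}.Finite := by
  induction T, hfin using Set.Finite.induction_on generalizing φ with
  | empty => exact (Set.finite_singleton φ).subset fun ψ h => (B.residue_empty h).symm
  | @insert s T hs _ ih =>
    have hT' : M.IsSpherical T := fun t ht u hu =>
      hT t (Set.mem_insert_of_mem _ ht) u (Set.mem_insert_of_mem _ hu)
    have hc : ∀ t ∈ T, t ≠ s ∧ M s t = 2 := fun t ht => by
      have hts : t ≠ s := fun e => hs (e ▸ ht)
      exact ⟨hts, hT s (Set.mem_insert _ _) t (Set.mem_insert_of_mem _ ht) hts.symm⟩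
    refine ((hB s φ).biUnion fun χ _ => ih hT' χ).subset fun ψ h => ?_
    obtain ⟨χ, h1, h2⟩ := B.exists_of_residue_insert hM hc h
    exact Set.mem_biUnion h1 h2

/-- The balls of a locally finite building are finite. -/
theorem finite_ball [Finite S] (hB : ∀ s φ, {ψ | B.panel s φ ψ}.Finite) (φ : C) (n : ℕ) :
    {ψ | ∃ ω : List S, ω.length = n ∧ B.HasGallery ω φ ψ}.Finite := by
  induction n generalizing φ with
  | zero =>
    refine (Set.finite_singleton φ).subset ?_
    rintro ψ ⟨ω, hω, h⟩
    obtain rfl := List.length_eq_zero_iff.1 hω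
    exact Eq.symm h
  | succ n ih =>
    refine (Set.finite_iUnion fun s => (hB s φ).biUnion fun χ _ => ih χ).subset ?_
    rintro ψ ⟨_ | ⟨s, ω⟩, hω, h⟩
    · simp at hω
    · obtain ⟨χ, h1, h2⟩ := h
      exact Set.mem_iUnion.2 ⟨s, Set.mem_biUnion h1.2 ⟨ω, by simpa using hω, h2⟩⟩

theorem point_eq_iff {φ ψ : C} {x y : M.DavisChamber} :
    B.point φ x = B.point ψ y ↔ x = y ∧ B.residue {s | x.1 s = 1} φ ψ :=
  Quotient.eq (r := B.glue)

theorem exists_point (p : B.Realization) : ∃ φ x, p = B.point φ x := by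
  obtain ⟨⟨φ, x⟩, rfl⟩ := Quotient.exists_rep p
  exact ⟨φ, x, rfl⟩

theorem continuous_point (φ : C) : Continuous (B.point φ) :=
  (continuous_quotient_mk' (s := B.glue)).comp
    (continuous_sigmaMk (σ := fun _ : C => M.DavisChamber) (i := φ))

theorem isOpen_iff {U : Set B.Realization} : IsOpen U ↔ ∀ φ, IsOpen (B.point φ ⁻¹' U) := by
  refine ⟨fun h φ => h.preimage (B.continuous_point φ), fun h => ?_⟩
  refine isOpen_coinduced.2 ?_
  exact isOpen_sigma_iff.2 h

/-- The open star of the point `x` of the chamber `φ`. -/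
def openStar (φ : C) (x : M.DavisChamber) : Set B.Realization :=
  {p | ∃ ψ y, p = B.point ψ y ∧ B.residue {s | x.1 s = 1} φ ψ ∧ ∀ s, x.1 s ≠ 1 → y.1 s ≠ 1}

theorem point_mem_openStar_iff {φ ψ : C} {x y : M.DavisChamber} :
    B.point ψ y ∈ B.openStar φ x ↔
      B.residue {s | x.1 s = 1} φ ψ ∧ ∀ s, x.1 s ≠ 1 → y.1 s ≠ 1 := by
  refine ⟨?_, fun h => ⟨ψ, y, rfl, h⟩⟩
  rintro ⟨ψ', y', h, h1, h2⟩
  obtain ⟨rfl, h3⟩ := B.point_eq_iff.1 h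
  refine ⟨(B.residue _).trans h1 ?_, h2⟩
  refine (B.residue _).symm (Relation.EqvGen.mono ?_ _ _ h3)
  rintro α β ⟨s, hs, h⟩
  exact ⟨s, by_contra fun hx => h2 s hx hs, h⟩

theorem isOpen_openStar [Finite S] (φ : C) (x : M.DavisChamber) : IsOpen (B.openStar φ x) := by
  refine B.isOpen_iff.2 fun ψ => ?_
  by_cases h : B.residue {s | x.1 s = 1} φ ψ
  · have : B.point ψ ⁻¹' B.openStar φ x =
        ⋂ s, {y : M.DavisChamber | x.1 s ≠ 1 → y.1 s ≠ 1} := by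
      ext y
      simp [point_mem_openStar_iff, h]
    rw [this]
    refine isOpen_iInter_of_finite fun s => ?_
    by_cases hs : x.1 s = 1
    · simp [hs]
    · have hc : Continuous fun y : M.DavisChamber => y.1 s :=
        (continuous_apply s).comp continuous_subtype_val
      simp only [ne_eq, hs, not_false_eq_true, true_imp_iff]
      exact (isOpen_compl_singleton (x := (1 : unitInterval))).preimage hc
  · convert isOpen_empty
    ext y
    simp [point_mem_openStar_iff, h]

/-- A compact subset of the realization is contained in finitely many chambers. -/
theorem exists_finite_cover [Finite S] (hM : M.IsRightAngled)
    (hB : ∀ s φ, {ψ | B.panel s φ ψ}.Finite) {K : Set B.Realization} (hK : IsCompact K) :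
    ∃ Q : Set C, Q.Finite ∧ ∀ p ∈ K, ∃ φ ∈ Q, ∃ x, p = B.point φ x := by
  refine hK.induction_on ⟨∅, Set.finite_empty, by simp⟩ ?_ ?_ ?_
  · rintro K L h ⟨Q, hQ, h'⟩
    exact ⟨Q, hQ, fun p hp => h' p (h hp)⟩
  · rintro K L ⟨Q, hQ, h⟩ ⟨Q', hQ', h'⟩
    refine ⟨Q ∪ Q', hQ.union hQ', ?_⟩
    rintro p (hp | hp)
    · obtain ⟨φ, hφ, hx⟩ := h p hp
      exact ⟨φ, Or.inl hφ, hx⟩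
    · obtain ⟨φ, hφ, hx⟩ := h' p hp
      exact ⟨φ, Or.inr hφ, hx⟩
  · intro p _
    obtain ⟨φ, x, rfl⟩ := B.exists_point p
    -- The mirrors through `x` form a spherical set, so the open star meets only the chambers of a
    -- finite residue.
    refine ⟨B.openStar φ x, mem_nhdsWithin_of_mem_nhds ((B.isOpen_openStar φ x).mem_nhds
      (B.point_mem_openStar_iff.2 ⟨(B.residue _).refl _, fun _ h => h⟩)),
      {ψ | B.residue {s | x.1 s = 1} φ ψ},
      B.finite_residue hM hB (Set.toFinite _) (fun s hs t ht => x.2 s ?_ t ?_) φ, ?_⟩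
    · exact fun h0 => one_ne_zero (hs.symm.trans h0)
    · exact fun h0 => one_ne_zero (ht.symm.trans h0)
    · rintro _ ⟨ψ, y, rfl, h, _⟩
      exact ⟨ψ, h, y, rfl⟩

/-- The filter on the automorphism group generated by the pointwise stabilizers of finite sets of
chambers. -/
def fixFilter : Filter B.TypeAut where
  sets := {A | ∃ Q : Set C, Q.Finite ∧ ∀ g : B.TypeAut, (∀ φ ∈ Q, g • φ = φ) → g ∈ A}
  univ_sets := ⟨∅, Set.finite_empty, fun _ _ => trivial⟩
  sets_of_superset := by
    rintro A A' ⟨Q, hQ, h⟩ hA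
    exact ⟨Q, hQ, fun g hg => hA (h g hg)⟩
  inter_sets := by
    rintro A A' ⟨Q, hQ, h⟩ ⟨Q', hQ', h'⟩
    exact ⟨Q ∪ Q', hQ.union hQ', fun g hg =>
      ⟨h g fun φ hφ => hg φ (Or.inl hφ), h' g fun φ hφ => hg φ (Or.inr hφ)⟩⟩

theorem mem_fixFilter {A : Set B.TypeAut} : A ∈ B.fixFilter ↔
    ∃ Q : Set C, Q.Finite ∧ ∀ g : B.TypeAut, (∀ φ ∈ Q, g • φ = φ) → g ∈ A := Iff.rfl

/-- A compact set lies in finitely many chambers, and an automorphism that fixes these chambers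
fixes every point of the set. -/
theorem fixFilter_le_nhds_one [Finite S] (hM : M.IsRightAngled)
    (hB : ∀ s φ, {ψ | B.panel s φ ψ}.Finite) : B.fixFilter ≤ 𝓝 1 := by
  rw [nhds_induced, ← Filter.tendsto_iff_comap, ContinuousMap.tendsto_nhds_compactOpen]
  intro K hK U _ hKU
  obtain ⟨Q, hQ, h⟩ := B.exists_finite_cover hM hB hK
  refine B.mem_fixFilter.2 ⟨Q, hQ, fun g hg p hp => ?_⟩
  have h1 : g • p = p := by
    obtain ⟨φ, hφ, x, rfl⟩ := h p hp
    rw [B.smul_point, hg φ hφ]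
  have h2 : (1 : B.TypeAut) • p ∈ U := hKU hp
  rw [one_smul] at h2
  change g • p ∈ U
  rwa [h1]

/-- The pointwise stabilizer of some finite set of chambers in a discrete group is trivial. -/
theorem exists_finite_eq_one [Finite S] (hM : M.IsRightAngled)
    (hB : ∀ s φ, {ψ | B.panel s φ ψ}.Finite) (Γ : Subgroup B.TypeAut) [DiscreteTopology Γ] :
    ∃ Q : Set C, Q.Finite ∧ ∀ g : Γ, (∀ φ ∈ Q, g • φ = φ) → g = 1 := by
  have h : ({1} : Set Γ) ∈ 𝓝 (1 : Γ) := (isOpen_discrete _).mem_nhds rfl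
  rw [nhds_subtype, Filter.mem_comap] at h
  obtain ⟨U, hU, h⟩ := h
  obtain ⟨Q, hQ, h'⟩ := B.mem_fixFilter.1 (B.fixFilter_le_nhds_one hM hB hU)
  exact ⟨Q, hQ, fun g hg => h (h' g hg)⟩

theorem hasGallery_smul (g : B.TypeAut) {ω : List S} {φ ψ : C} (h : B.HasGallery ω φ ψ) :
    B.HasGallery ω (g • φ) (g • ψ) := by
  induction ω generalizing φ with
  | nil => exact congrArg (g • ·) h
  | cons s ω ih =>
    obtain ⟨χ, h1, h2⟩ := h
    exact ⟨g • χ, ⟨(MulAction.injective g).ne h1.1, (B.panel_smul_iff g s φ χ).2 h1.2⟩, ih h2⟩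

/-- Stabilizers of chambers in a discrete group of automorphisms of a locally finite building are
finite. -/
theorem finite_stabilizer [Finite S] (hM : M.IsRightAngled)
    (hB : ∀ s φ, {ψ | B.panel s φ ψ}.Finite) (Γ : Subgroup B.TypeAut) [DiscreteTopology Γ]
    (φ : C) : Finite (MulAction.stabilizer Γ φ) := by
  obtain ⟨Q, hQ, h⟩ := B.exists_finite_eq_one hM hB Γ
  have hf : ∀ ψ : C, (MulAction.orbit (MulAction.stabilizer Γ φ) ψ).Finite := by
    intro ψ
    obtain ⟨ω, _, _, h1⟩ := B.exists_gallery φ ψ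
    refine (B.finite_ball hB φ ω.length).subset ?_
    rintro _ ⟨g, rfl⟩
    refine ⟨ω, rfl, ?_⟩
    have h2 := B.hasGallery_smul (g : Γ).1 h1
    have h3 : (g : Γ).1 • φ = φ := g.2
    rwa [h3] at h2
  have : Finite Q := hQ
  have := fun ψ => (hf ψ).to_subtype
  -- An element is determined by its action on the finite set `Q`, and the orbit of each chamber of
  -- `Q` is finite because it lies in a ball around `φ`.
  refine Finite.of_injective (β := (ψ : Q) → MulAction.orbit (MulAction.stabilizer Γ φ) (ψ : C))
    (fun (g : MulAction.stabilizer Γ φ) ψ => ⟨g • (ψ : C), g, rfl⟩) ?_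
  intro g g' e
  have h1 : (g : Γ)⁻¹ * g' = 1 := by
    refine h _ fun ψ hψ => ?_
    have h2 : g • ψ = g' • ψ :=
      congrArg Subtype.val (congrFun e ⟨ψ, hψ⟩)
    rw [mul_smul, inv_smul_eq_iff]
    exact h2.symm
  exact Subtype.ext (eq_of_inv_mul_eq_one h1)

theorem isClosed_isSpherical [Finite S] :
    IsClosed {x : S → unitInterval | M.IsSpherical {s | x s ≠ 0}} := by
  have : {x : S → unitInterval | M.IsSpherical {s | x s ≠ 0}} =
      ⋂ s, ⋂ t, {x | s ≠ t → M s t ≠ 2 → x s = 0 ∨ x t = 0} := by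
    ext x
    simp only [CoxeterMatrix.IsSpherical, Set.mem_ofPred_eq, Set.mem_iInter]
    constructor
    · intro h s t hst hm
      by_contra! hx
      exact hm (h s hx.1 t hx.2 hst)
    · intro h s hs t ht hst
      by_contra hm
      exact (h s t hst hm).elim hs ht
  rw [this]
  refine isClosed_iInter fun s => isClosed_iInter fun t => ?_
  by_cases h : s ≠ t ∧ M s t ≠ 2
  · have : {x : S → unitInterval | s ≠ t → M s t ≠ 2 → x s = 0 ∨ x t = 0} =
        {x | x s = 0} ∪ {x | x t = 0} := by
      ext x
      simp [h.1, h.2]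
    rw [this]
    exact (isClosed_eq (continuous_apply s) continuous_const).union
      (isClosed_eq (continuous_apply t) continuous_const)
  · convert isClosed_univ
    ext x
    simpa using fun h1 h2 => absurd ⟨h1, h2⟩ h

/-- A group of automorphisms with finitely many orbits of chambers is cocompact. -/
theorem isCocompact_of_finite [Finite S] (Γ : Subgroup B.TypeAut) {F : Set C} (hF : F.Finite)
    (h : ∀ φ : C, ∃ g : Γ, g • φ ∈ F) : B.IsCocompact Γ := by
  have : CompactSpace M.DavisChamber := isCompact_iff_compactSpace.1 isClosed_isSpherical.isCompact
  have hq : Continuous (Quotient.mk (MulAction.orbitRel Γ B.Realization)) := continuous_quotient_mk'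
  refine ⟨?_⟩
  refine (hF.isCompact_biUnion fun φ _ =>
    isCompact_range (hq.comp (B.continuous_point φ))).of_isClosed_subset isClosed_univ ?_
  rintro p -
  obtain ⟨p, rfl⟩ := Quotient.exists_rep p
  obtain ⟨φ, x, rfl⟩ := B.exists_point p
  obtain ⟨g, hg⟩ := h φ
  refine Set.mem_biUnion hg ⟨x, Quotient.sound ?_⟩
  exact ⟨g, rfl⟩

end Building

/-! ### From strict fundamental domains to retractions -/

namespace Building

variable {S W : Type*} [Group W] {M : CoxeterMatrix S} {cs : CoxeterSystem M W} {C : Type*}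
  (B : Building cs C)

/-- The center of the Davis chamber: the vertex that corresponds to the empty set. -/
def _root_.CoxeterMatrix.center (M : CoxeterMatrix S) : M.DavisChamber :=
  ⟨fun _ => 0, fun _ hs => absurd rfl hs⟩

/-- The vertex of the Davis chamber that corresponds to the set `{s}`. -/
noncomputable def _root_.CoxeterMatrix.mirrorVertex (M : CoxeterMatrix S) (s : S) :
    M.DavisChamber := by
  classical
  refine ⟨fun t => if t = s then 1 else 0, fun t ht u hu htu => ?_⟩
  have h : ∀ v ∈ {v | (if v = s then 1 else 0 : unitInterval) ≠ 0}, v = s := fun v hv =>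
    by_contra fun hvs => hv (if_neg hvs)
  exact absurd ((h t ht).trans (h u hu).symm) htu

theorem _root_.CoxeterMatrix.mirrorVertex_eq_one (M : CoxeterMatrix S) (s : S) :
    {t | (M.mirrorVertex s).1 t = 1} = {s} := by
  classical
  ext t
  by_cases h : t = s <;> simp [CoxeterMatrix.mirrorVertex, h]

theorem eq_of_point_center_eq {φ ψ : C} (h : B.point φ M.center = B.point ψ M.center) :
    φ = ψ := by
  have h1 : {s : S | M.center.1 s = 1} = ∅ := by
    ext s
    simp [CoxeterMatrix.center]
  have h2 := (B.point_eq_iff.1 h).2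
  rw [h1] at h2
  exact B.residue_empty h2

variable {B}

theorem IsStrictFundamentalDomain.eq_of_mem_orbit {Γ : Subgroup B.TypeAut}
    {Y : Set B.Realization} (hY : B.IsStrictFundamentalDomain Γ Y) {p q : B.Realization}
    (hp : p ∈ Y) (hq : q ∈ Y) (h : q ∈ MulAction.orbit Γ p) : p = q :=
  (hY.2 p).unique ⟨hp, MulAction.mem_orbit_self p⟩ ⟨hq, h⟩

/-- A strict fundamental domain contains every chamber whose center it contains. -/
theorem IsStrictFundamentalDomain.point_mem {Γ : Subgroup B.TypeAut} {Y : Set B.Realization}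
    (hY : B.IsStrictFundamentalDomain Γ Y) {φ : C} (hφ : B.point φ M.center ∈ Y)
    (x : M.DavisChamber) : B.point φ x ∈ Y := by
  classical
  let a : unitInterval := ⟨1 / 2, by norm_num, by norm_num⟩
  have a0 : a ≠ 0 := fun h => by
    have := congrArg Subtype.val h
    norm_num [a] at this
  have a1 : a ≠ 1 := fun h => by
    have := congrArg Subtype.val h
    norm_num [a] at this
  -- Replacing the nonzero coordinates of `x` by 1/2 gives a point on no mirror. A cell of `Y`
  -- containing a translate of it lies in a single chamber, has `A` empty, and so contains the
  -- corresponding translates of the center and of `x`.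
  let y : M.DavisChamber := ⟨fun s => if x.1 s = 0 then 0 else a, fun s hs t ht =>
    x.2 s (fun h => hs (if_pos h)) t (fun h => ht (if_pos h))⟩
  have y0 : ∀ s, y.1 s = 0 → x.1 s = 0 := fun s hs => by
    by_contra hx
    exact a0 ((if_neg hx).symm.trans hs)
  have y1 : ∀ s, y.1 s ≠ 1 := fun s => by
    by_cases hx : x.1 s = 0 <;> simp [y, hx, a1]
  obtain ⟨_, ⟨hyY, g, rfl⟩, -⟩ := hY.2 (B.point φ y)
  change B.point (g • φ) y ∈ Y at hyY
  obtain ⟨F, hF, rfl⟩ := hY.1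
  obtain ⟨c, hc, hyc⟩ := hyY
  obtain ⟨ψ, A, T, hA, hT, rfl⟩ := hF c hc
  obtain ⟨z, ⟨hzA, hzT⟩, hz⟩ := hyc
  obtain ⟨rfl, h⟩ := B.point_eq_iff.1 hz
  have h1 : {s | y.1 s = 1} = ∅ := by
    ext s
    simpa using y1 s
  rw [h1] at h
  have hψ := B.residue_empty h
  have hA' : ∀ s, s ∉ A := fun s hs => y1 s (hzA s hs)
  have key : ∀ w : M.DavisChamber, (∀ s, x.1 s = 0 → w.1 s = 0) → B.point (g • φ) w ∈ ⋃₀ F :=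
    fun w hw => ⟨_, hc, hψ ▸ ⟨w, ⟨fun s hs => absurd hs (hA' s),
      fun s hs => hw s (y0 s (hzT s hs))⟩, rfl⟩⟩
  have h2 := hY.eq_of_mem_orbit hφ (key M.center fun _ _ => rfl) ⟨g, rfl⟩
  have h3 := key x fun _ h => h
  rwa [← B.eq_of_point_center_eq h2] at h3

/-- A strict fundamental domain defines a retraction of the set of chambers onto a set of
representatives of the orbits. -/
theorem IsStrictFundamentalDomain.exists_retraction {Γ : Subgroup B.TypeAut}
    {Y : Set B.Realization} (hY : B.IsStrictFundamentalDomain Γ Y) :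
    ∃ r : C → C, (∀ (g : Γ) φ, r (g • φ) = r φ) ∧ (∀ φ, ∃ g : Γ, r φ = g • φ) ∧
      ∀ s φ ψ, B.panel s φ ψ → B.panel s (r φ) (r ψ) := by
  have hex : ∀ φ : C, ∃ ψ, B.point ψ M.center ∈ Y ∧ ∃ g : Γ, ψ = g • φ := by
    intro φ
    obtain ⟨_, ⟨h, g, rfl⟩, -⟩ := hY.2 (B.point φ M.center)
    exact ⟨g • φ, h, g, rfl⟩
  choose r hr k hk using hex
  refine ⟨r, fun g φ => ?_, fun φ => ⟨k φ, hk φ⟩, fun s φ ψ h => ?_⟩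
  · refine B.eq_of_point_center_eq (hY.eq_of_mem_orbit (hr _) (hr _) ?_)
    refine ⟨k φ * g⁻¹ * (k (g • φ))⁻¹, ?_⟩
    change B.point ((k φ * g⁻¹ * (k (g • φ))⁻¹) • r (g • φ)) M.center = _
    rw [hk (g • φ), hk φ]
    simp [mul_smul]
  · have h1 : B.panel s (k φ • φ) (k φ • ψ) := (B.panel_smul_iff (k φ).1 s φ ψ).2 h
    have h2 : B.point (r φ) (M.mirrorVertex s) = B.point (k φ • ψ) (M.mirrorVertex s) := by
      rw [hk φ, B.point_eq_iff, M.mirrorVertex_eq_one]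
      exact ⟨rfl, B.residue_of_panel (Set.mem_singleton s) h1⟩
    -- The mirror vertices of `r φ` and `r ψ` are in one orbit and both in `Y`, so they coincide and
    -- the two chambers share a panel.
    have h3 := hY.eq_of_mem_orbit (hY.point_mem (hr ψ) (M.mirrorVertex s))
      (hY.point_mem (hr φ) (M.mirrorVertex s)) ⟨k φ * (k ψ)⁻¹, by
        change B.point ((k φ * (k ψ)⁻¹) • r ψ) _ = _
        rw [h2, hk ψ, mul_smul, inv_smul_smul]⟩
    rw [B.point_eq_iff, M.mirrorVertex_eq_one] at h3
    exact (B.panel s).symm (B.residue_singleton h3.2)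

/-! ### Finite generation and the growth of stabilizers -/

variable (B)

theorem panel_smul {Γ : Subgroup B.TypeAut} (g : Γ) {s : S} {φ ψ : C} (h : B.panel s φ ψ) :
    B.panel s (g • φ) (g • ψ) :=
  (B.panel_smul_iff g.1 s φ ψ).2 h

/-- Two chambers in a common panel, the first of which is mapped into `E` by `r`. -/
def StepIn (r : C → C) (E : Set C) (α β : C) : Prop := ∃ t, B.panel t α β ∧ r α ∈ E

theorem stepIn_mono (r : C → C) {E E' : Set C} (h : E ⊆ E') {α β : C}
    (hE : Relation.EqvGen (B.StepIn r E) α β) : Relation.EqvGen (B.StepIn r E') α β :=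
  Relation.EqvGen.mono (fun _ _ ⟨t, ht, hr⟩ => ⟨t, ht, h hr⟩) _ _ hE

theorem exists_finite_stepIn (r : C → C) (φ ψ : C) :
    ∃ E : Set C, E.Finite ∧ Relation.EqvGen (B.StepIn r E) φ ψ := by
  obtain ⟨ω, -, -, h⟩ := B.exists_gallery φ ψ
  induction ω generalizing φ with
  | nil => exact ⟨∅, Set.finite_empty, h ▸ .refl _⟩
  | cons s ω ih =>
    obtain ⟨χ, h1, h2⟩ := h
    obtain ⟨E, hE, h3⟩ := ih χ h2
    exact ⟨insert (r φ) E, hE.insert _, .trans _ χ _ (.rel _ _ ⟨s, h1.2, Set.mem_insert _ _⟩)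
      (B.stepIn_mono r (Set.subset_insert _ _) h3)⟩

theorem eqvGen_smul {Γ : Subgroup B.TypeAut} (g : Γ) {R R' : C → C → Prop}
    (h : ∀ α β, R α β → R' (g • α) (g • β)) {α β : C} (hR : Relation.EqvGen R α β) :
    Relation.EqvGen R' (g • α) (g • β) := by
  induction hR with
  | rel α β hR => exact .rel _ _ (h α β hR)
  | refl α => exact .refl _
  | symm α β _ ih => exact .symm _ _ ih
  | trans α β γ _ _ ih ih' => exact .trans _ _ _ ih ih'

/-- If `Γ` is finitely generated, then the preimage of some finite set of orbits of chambers
connects the chambers of an orbit. -/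
theorem exists_finite_stepIn_orbit {Γ : Subgroup B.TypeAut} (hΓ : Group.FG Γ) {r : C → C}
    (hr : ∀ (g : Γ) φ, r (g • φ) = r φ) (φ : C) :
    ∃ E : Set C, E.Finite ∧ ∀ g : Γ, Relation.EqvGen (B.StepIn r E) φ (g • φ) := by
  obtain ⟨F, hF⟩ := hΓ.out
  choose E hE h using fun g : Γ => B.exists_finite_stepIn r φ (g • φ)
  refine ⟨⋃ g ∈ F, E g, F.finite_toSet.biUnion fun g _ => hE g, fun g => ?_⟩
  -- Since `r` is constant on orbits, `Γ` permutes the steps allowed by `E`; paths for generators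
  -- can thus be concatenated.
  have hs : ∀ (g : Γ) {α β : C}, Relation.EqvGen (B.StepIn r (⋃ g ∈ F, E g)) α β →
      Relation.EqvGen (B.StepIn r (⋃ g ∈ F, E g)) (g • α) (g • β) := fun g _ _ h =>
    B.eqvGen_smul g (fun α β ⟨t, ht, hα⟩ => ⟨t, B.panel_smul g ht, (hr g α).symm ▸ hα⟩) h
  have hg : g ∈ Subgroup.closure (F : Set Γ) := hF ▸ Subgroup.mem_top g
  induction hg using Subgroup.closure_induction with
  | mem g hg => exact B.stepIn_mono r (Set.subset_biUnion_of_mem hg) (h g)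
  | one => rw [one_smul]; exact .refl _
  | mul g g' _ _ ih ih' => rw [mul_smul]; exact .trans _ _ _ ih (hs g ih')
  | inv g _ ih =>
    have := hs g⁻¹ ih
    rw [inv_smul_smul] at this
    exact .symm _ _ this

/-- If the wall of type `s` of `χ` does not meet `E`, then `χ` is the only chamber of its `Γ`-orbit
in its `s`-panel. -/
theorem smul_eq_of_panel (hM : M.IsRightAngled) {Γ : Subgroup B.TypeAut} {r : C → C}
    (hrp : ∀ s φ ψ, B.panel s φ ψ → B.panel s (r φ) (r ψ)) {E : Set C} {φ : C}
    (hE : ∀ g : Γ, Relation.EqvGen (B.StepIn r E) φ (g • φ)) {s : S} {χ : C} (hχ : r χ = χ)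
    (hEχ : ∀ e ∈ E, ¬ B.residue (M.star s) χ e) (hφ : Relation.EqvGen (B.OffWall s χ) φ χ)
    (g : Γ) (hg : B.panel s χ (g • χ)) : g • χ = χ := by
  have h1 : Relation.EqvGen (B.OffWall s χ) φ (g • φ) := by
    refine Relation.EqvGen.mono ?_ _ _ (hE g)
    rintro α β ⟨t, ht, hα⟩
    -- If the step crossed the wall, applying `r`, which fixes `χ`, would put `r α`, an element of
    -- `E`, in the residue of the wall.
    refine ⟨t, ht, fun _ h => hEχ _ hα ?_⟩
    have := B.residue_map hrp h
    rwa [hχ] at this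
  have h2 : Relation.EqvGen (B.OffWall s χ) (g • φ) (g • χ) := by
    refine B.eqvGen_smul g ?_ hφ
    rintro α β ⟨t, ht, h⟩
    refine ⟨t, B.panel_smul g ht, fun hts h' => h hts ?_⟩
    -- As `χ` and `g • χ` share an `s`-panel, they define the same wall, so `g⁻¹` pulls a crossing
    -- back to the wall of `χ`.
    have h3 := (B.residue _).trans
      ((B.residue (M.star s)).symm (B.residue_of_panel (M.self_mem_star s) hg)) h'
    have h4 := B.residue_smul g⁻¹.1 _ h3
    have e : ∀ ξ : C, g⁻¹.1 • g • ξ = ξ := fun ξ => inv_smul_smul g ξ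
    rwa [e, e] at h4
  exact (B.eq_of_offWall hM hg (.trans _ _ _ (.symm _ _ hφ) (.trans _ _ _ h1 h2))).symm

/-- An element fixing `ψ` preserves the panel, hence moves `χ` inside it and so fixes `χ`. -/
theorem card_stabilizer_le_of_panel {Γ : Subgroup B.TypeAut} {s : S} {χ ψ : C}
    (h : B.panel s χ ψ) (hχ : ∀ g : Γ, B.panel s χ (g • χ) → g • χ = χ)
    [Finite (MulAction.stabilizer Γ χ)] :
    Nat.card (MulAction.stabilizer Γ ψ) ≤ Nat.card (MulAction.stabilizer Γ χ) := by
  refine Subgroup.card_le_of_le fun g hg => hχ g ?_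
  have h1 := B.panel_smul g h
  rw [MulAction.mem_stabilizer_iff.1 hg] at h1
  exact (B.panel s).trans h ((B.panel s).symm h1)

/-- The stabilizer of `ψ` acts on the panel; an element is determined by the image of `χ` and an
element of the stabilizer of `χ`, through a chosen `k` carrying `χ` to that image. -/
theorem card_stabilizer_le_mul_of_panel {Γ : Subgroup B.TypeAut} {s : S} {χ ψ : C}
    (h : B.panel s χ ψ) [Finite {ξ // B.panel s χ ξ}] [Finite (MulAction.stabilizer Γ χ)] :
    Nat.card (MulAction.stabilizer Γ ψ) ≤
      Nat.card {ξ // B.panel s χ ξ} * Nat.card (MulAction.stabilizer Γ χ) := by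
  classical
  have hex : ∀ ξ : C, ∃ k : Γ, (∃ g : Γ, g • χ = ξ) → k • χ = ξ := fun ξ => by
    by_cases h : ∃ g : Γ, g • χ = ξ
    · exact ⟨h.choose, fun _ => h.choose_spec⟩
    · exact ⟨1, fun h' => absurd h' h⟩
  choose k hk using hex
  have hk' : ∀ g : Γ, k (g • χ) • χ = g • χ := fun g => hk _ ⟨g, rfl⟩
  rw [← Nat.card_prod]
  refine Nat.card_le_card_of_injective
    (fun g : MulAction.stabilizer Γ ψ => (⟨g.1 • χ, ?_⟩, ⟨(k (g.1 • χ))⁻¹ * g.1, ?_⟩)) ?_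
  · have h1 := B.panel_smul g.1 h
    rw [MulAction.mem_stabilizer_iff.1 g.2] at h1
    exact (B.panel s).trans h ((B.panel s).symm h1)
  · rw [MulAction.mem_stabilizer_iff, mul_smul, inv_smul_eq_iff, hk' g.1]
  · intro g g' e
    have e1 : g.1 • χ = g'.1 • χ := congrArg (fun p => (p.1 : C)) e
    have e2 : (k (g.1 • χ))⁻¹ * g.1 = (k (g'.1 • χ))⁻¹ * g'.1 :=
      congrArg (fun p => (p.2 : Γ)) e
    rw [e1] at e2
    exact Subtype.ext (mul_left_cancel e2)

/-- If `Γ` is finitely generated and has a strict fundamental domain, then the orders of the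
stabilizers of chambers are bounded. -/
theorem exists_card_stabilizer_le [Finite S] (hM : M.IsRightAngled)
    (hB : ∀ s φ, {ψ | B.panel s φ ψ}.Finite) {Q : ℕ} (hQ1 : 1 ≤ Q)
    (hQ : ∀ s φ, Nat.card {ψ // B.panel s φ ψ} ≤ Q) {Γ : Subgroup B.TypeAut}
    (hfin : ∀ φ : C, Finite (MulAction.stabilizer Γ φ)) (hΓ : Group.FG Γ) {r : C → C}
    (hr : ∀ (g : Γ) φ, r (g • φ) = r φ) (hro : ∀ φ, ∃ g : Γ, r φ = g • φ)
    (hrp : ∀ s φ ψ, B.panel s φ ψ → B.panel s (r φ) (r ψ)) :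
    ∃ N, ∀ ψ : C, Nat.card (MulAction.stabilizer Γ ψ) ≤ N := by
  classical
  have hrr : ∀ φ, r (r φ) = r φ := fun φ => by
    obtain ⟨g, hg⟩ := hro φ
    nth_rewrite 1 [hg]
    exact hr g φ
  obtain ⟨φ₁⟩ := B.nonempty
  obtain ⟨φ, hφ⟩ : ∃ φ, r φ = φ := ⟨r φ₁, hrr φ₁⟩
  obtain ⟨E, hEfin, hE⟩ := B.exists_finite_stepIn_orbit hΓ hr φ
  have : Finite E := hEfin
  have := Fintype.ofFinite S
  have := Fintype.ofFinite E
  refine ⟨Q ^ Fintype.card (S × E) * Nat.card (MulAction.stabilizer Γ φ), fun ψ => ?_⟩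
  have hcard : Nat.card (MulAction.stabilizer Γ ψ) = Nat.card (MulAction.stabilizer Γ (r ψ)) := by
    obtain ⟨g, hg⟩ := hro ψ
    rw [hg]
    exact Nat.card_congr (MulAction.stabilizerEquivStabilizer rfl).toEquiv
  rw [hcard]
  obtain ⟨ω, c, hω, c0, cn, hcr, hc⟩ := B.exists_gallery_fixed hrp hrr hφ (hrr ψ)
  -- A step is bad if the wall it crosses meets `E`; the stabilizer can grow only there.
  let bad : ℕ → Prop := fun i => ∃ hi : i < ω.length, ∃ e ∈ E, B.residue (M.star ω[i]) (c i) e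
  have hstep : ∀ n ≤ ω.length, Nat.card (MulAction.stabilizer Γ (c n)) ≤
      Q ^ ((Finset.range n).filter bad).card * Nat.card (MulAction.stabilizer Γ φ) := by
    intro n
    induction n with
    | zero => simp [c0]
    | succ n ih =>
      intro hn
      have ih := ih (by omega)
      have hp := (hc n hn).2
      have := hfin (c n)
      rw [Finset.range_add_one, Finset.filter_insert]
      by_cases hb : bad n
      · rw [if_pos hb, Finset.card_insert_of_notMem (by simp), pow_succ']
        have : Finite {ξ // B.panel ω[n] (c n) ξ} := hB _ _
        calc _ ≤ _ := B.card_stabilizer_le_mul_of_panel hp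
          _ ≤ Q * _ := Nat.mul_le_mul (hQ _ _) ih
          _ = _ := by rw [mul_assoc]
      · rw [if_neg hb]
        refine (B.card_stabilizer_le_of_panel hp ?_).trans ih
        refine B.smul_eq_of_panel hM hrp hE (hcr n) (fun e he h => hb ⟨hn, e, he, h⟩) ?_
        -- The earlier part of the geodesic does not cross the wall of step `n`.
        have hpath : ∀ j ≤ n, Relation.EqvGen (B.OffWall ω[n] (c n)) φ (c j) := by
          intro j
          induction j with
          | zero => intro _; rw [c0]; exact .refl _
          | succ j ihj =>
            intro hj
            refine .trans _ _ _ (ihj (by omega)) (.rel _ _ ⟨ω[j], (hc j (by omega)).2, ?_⟩)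
            intro e h
            refine B.not_residue_star_of_lt hM hω hc hj hn e ?_
            rw [e]
            exact (B.residue _).symm h
        exact hpath n le_rfl
  -- Two bad steps with the same letter and the same witness in `E` would cross the same wall.
  have hbad : ((Finset.range ω.length).filter bad).card ≤ Fintype.card (S × E) := by
    choose hlt e heE he using fun (i : ℕ) (hi : bad i) => hi
    let f : ((Finset.range ω.length).filter bad) → S × E := fun i =>
      have hb := (Finset.mem_filter.1 i.2).2
      (ω[i.1]'(hlt _ hb), ⟨e _ hb, heE _ hb⟩)
    have hf : ∀ i j, i.1 < j.1 → f i ≠ f j := by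
      intro i j hij h
      have hi := (Finset.mem_filter.1 i.2).2
      have hj := (Finset.mem_filter.1 j.2).2
      have h1 : ω[i.1]'(hlt _ hi) = ω[j.1]'(hlt _ hj) := congrArg Prod.fst h
      have h2 : e _ hi = e _ hj := congrArg (fun p => (p.2 : C)) h
      refine B.not_residue_star_of_lt hM hω hc hij (hlt _ hj) h1 ?_
      have h3 := he _ hi
      have h4 := he _ hj
      rw [← h1, ← h2] at h4
      exact (B.residue _).trans h3 ((B.residue _).symm h4)
    have hinj : Function.Injective f := by
      intro i j h
      rcases lt_trichotomy i.1 j.1 with hij | hij | hij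
      · exact absurd h (hf i j hij)
      · exact Subtype.ext hij
      · exact absurd h.symm (hf j i hij)
    simpa using Fintype.card_le_of_injective f hinj
  have h1 := hstep ω.length le_rfl
  rw [cn] at h1
  exact h1.trans (Nat.mul_le_mul_right _ (Nat.pow_le_pow_right hQ1 hbad))

end Building

/-! ### Bounded stabilizers and cocompactness -/

theorem finite_of_summable_inv_natCast {ι : Type*} {a : ι → ℕ} {N : ℕ} (h0 : ∀ i, 0 < a i)
    (hN : ∀ i, a i ≤ N) (hs : Summable fun i => ((a i : ℝ))⁻¹) : Finite ι := by
  rcases isEmpty_or_nonempty ι with _ | ⟨⟨i⟩⟩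
  · infer_instance
  have hNpos : (0 : ℝ) < N := by exact_mod_cast (h0 i).trans_le (hN i)
  have hs' : Summable fun _ : ι => (N : ℝ)⁻¹ :=
    hs.of_nonneg_of_le (fun _ => by positivity) fun j =>
      inv_anti₀ (by exact_mod_cast h0 j) (by exact_mod_cast hN j)
  by_contra hinf
  rw [not_finite_iff_infinite] at hinf
  exact (inv_pos.2 hNpos).ne' ((summable_const_iff _).1 hs')

theorem theorem1 {S W C : Type*} [Finite S] [Group W] {M : CoxeterMatrix S}
    (hM : M.IsRightAngled) (cs : CoxeterSystem M W) (B : Building cs C)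
    (q : S → ℕ) (hq : ∀ s, 2 ≤ q s) (hreg : B.IsRegular q)
    (G : Subgroup B.TypeAut) (hGclosed : IsClosed (G : Set B.TypeAut))
    (hGcocompact : B.IsCocompact G)
    (Γ : Subgroup B.TypeAut) (hΓ : B.IsLattice G Γ) (hΓnc : ¬ B.IsCocompact Γ)
    (hY : ∃ Y : Set B.Realization, B.IsStrictFundamentalDomain Γ Y) :
    ¬ Group.FG Γ := by
  intro hfg
  obtain ⟨Y, hY⟩ := hY
  obtain ⟨-, hdisc, F, hF, hsum⟩ := hΓ
  have hB : ∀ s φ, {ψ | B.panel s φ ψ}.Finite := fun s φ => by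
    have h : 0 < Nat.card {ψ // B.panel s φ ψ} := by
      rw [hreg s φ]
      exact two_pos.trans_le (hq s)
    exact (Nat.card_pos_iff.1 h).2
  obtain ⟨r, hr, hro, hrp⟩ := hY.exists_retraction
  obtain ⟨Q, hQ⟩ := (Set.finite_range q).bddAbove
  have hfin := B.finite_stabilizer hM hB Γ
  -- The bound `Q + 1` is positive even when `S` is empty, where `Q` may be 0.
  obtain ⟨N, hN⟩ := B.exists_card_stabilizer_le hM hB (Q := Q + 1) (by omega)
    (fun s φ => by rw [hreg s φ]; exact (hQ ⟨s, rfl⟩).trans (Nat.le_succ Q)) hfin hfg hr hro hrp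
  have hFfin : Finite F := finite_of_summable_inv_natCast (fun _ => Nat.card_pos)
    (fun φ => hN φ) hsum
  refine hΓnc (B.isCocompact_of_finite Γ hFfin fun φ => ?_)
  obtain ⟨_, ⟨h, g, rfl⟩, -⟩ := hF φ
  exact ⟨g, h⟩
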